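/- For $t\in\{2,3\}$, let $\mu_H$ be the Haar probability measure on the unitary group $\mathbb{U}(4)$ of two qubits $\mathbb{C}^2\otimes\mathbb{C}^2$, and put $$P:=\int_{\mathbb{U}(4)} U^{\otimes t}\otimes\overline{U}^{\otimes t}\,\mu_H(dU),$$ where $\overline{U}$ is the entrywise complex conjugate of $U$ in the standard basis. With $\mathcal{K}_i:=(\mathbb{C}^2)^{\otimes t}\otimes(\mathbb{C}^2)^{\otimes t}$ the space of the $2t$ copies of the $i$-th qubit ($i=1,2,3$), and after the obvious reordering of tensor factors, let $P_{12}$ denote $P$ as an operator on $\mathcal{K}_1\otimes\mathcal{K}_2$ and $P_{23}$ denote $P$ as an operator on $\mathcal{K}_2\otimes\mathcal{K}_3$. Then the operator $$M_{t,3}:=\tfrac12\left(P_{12}\otimes \mathbb{I}_3+\mathbb{I}_1\otimes P_{23}\right)$$ on $\mathcal{K}_1\otimes\mathcal{K}_2\otimes\mathcal{K}_3$, which is Hermitian, has second largest eigenvalue $$\lambda_2(M_{t,3})=\frac{7}{10},$$ where the eigenvalues are counted without multiplicity, i.e. $\lambda_2(M_{t,3})$ is the largest eigenvalue of $M_{t,3}$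 that differs from its top eigenvalue. -/

import Mathlib

open MeasureTheory
open scoped Kronecker

noncomputable section

namespace RandomCircuit

/-! ### The normalized Haar measure on the unitary group of `ℂ^m` -/

instance unitaryGroupCompactSpace (m : Type*) [Fintype m] [DecidableEq m] :
    CompactSpace (Matrix.unitaryGroup m ℂ) := by
  have hK : IsCompact (Set.univ.pi fun _ : m => Set.univ.pi fun _ : m =>
      Metric.closedBall (0 : ℂ) 1) :=
    isCompact_univ_pi fun _ => isCompact_univ_pi fun _ => isCompact_closedBall _ _
  have hclosed : IsClosed (Matrix.unitaryGroup m ℂ : Set (Matrix m m ℂ)) :=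
    isClosed_unitary
  refine isCompact_iff_compactSpace.mp (hK.of_isClosed_subset hclosed ?_)
  intro U hU i _ j _
  simpa using entry_norm_bound_of_unitary hU i j

instance unitaryGroupMeasurableSpace (m : Type*) [Fintype m] [DecidableEq m] :
    MeasurableSpace (Matrix.unitaryGroup m ℂ) := borel _

instance unitaryGroupBorelSpace (m : Type*) [Fintype m] [DecidableEq m] :
    BorelSpace (Matrix.unitaryGroup m ℂ) := ⟨rfl⟩

/-- The Haar measure on `𝕌(m)`, normalized to have total mass one. -/
def haarUnitary (m : Type*) [Fintype m] [DecidableEq m] :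
    Measure (Matrix.unitaryGroup m ℂ) :=
  Measure.haarMeasure ⊤

/-! ### Moment operators -/

/-- The `t`-fold tensor power `A^{⊗ t}`, as a matrix on `(ℂ^m)^{⊗ t}`, whose standard basis is
indexed by `Fin t → m`. -/
def tensorPow {m : Type*} (t : ℕ) (A : Matrix m m ℂ) : Matrix (Fin t → m) (Fin t → m) ℂ :=
  Matrix.of fun i j => ∏ k, A (i k) (j k)

/-- The integrand `U^{⊗ t} ⊗ Ū^{⊗ t}`, where `Ū` is the entrywise complex conjugate. -/
def tensorPowConj {m : Type*} (t : ℕ) (U : Matrix m m ℂ) :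
    Matrix ((Fin t → m) × (Fin t → m)) ((Fin t → m) × (Fin t → m)) ℂ :=
  tensorPow t U ⊗ₖ tensorPow t (U.map star)

/-- The `t`-th Haar moment operator `∫ U^{⊗ t} ⊗ Ū^{⊗ t} dμ_H(U)` on
`(ℂ^m)^{⊗ t} ⊗ (ℂ^m)^{⊗ t}`; the integral is taken entrywise. -/
def haarMoment (m : Type*) [Fintype m] [DecidableEq m] (t : ℕ) :
    Matrix ((Fin t → m) × (Fin t → m)) ((Fin t → m) × (Fin t → m)) ℂ :=
  Matrix.of fun i j =>
    ∫ U : Matrix.unitaryGroup m ℂ, tensorPowConj t (U : Matrix m m ℂ) i j ∂(haarUnitary m)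

/-- The index set of the standard basis of the `2t` copies `(ℂ²)^{⊗ t} ⊗ (ℂ²)^{⊗ t}` of a
single qubit. -/
abbrev QubitCopies (t : ℕ) : Type := (Fin t → Fin 2) × (Fin t → Fin 2)

/-- Reordering of tensor factors which identifies (all copies of a first qubit) ⊗
(all copies of a second qubit) with `2t` copies of the pair of qubits. -/
def regroup (t : ℕ) :
    QubitCopies t × QubitCopies t ≃
      (Fin t → Fin 2 × Fin 2) × (Fin t → Fin 2 × Fin 2) where
  toFun x := (fun k => (x.1.1 k, x.2.1 k), fun k => (x.1.2 k, x.2.2 k))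
  invFun y := ((fun k => (y.1 k).1, fun k => (y.2 k).1), (fun k => (y.1 k).2, fun k => (y.2 k).2))
  left_inv _ := rfl
  right_inv _ := rfl

/-- The Haar projector `P` of two qubits: `∫ U^{⊗ t} ⊗ Ū^{⊗ t} dμ_H(U)` over `𝕌(4)`, with the
copies of the first qubit and the copies of the second qubit grouped together. -/
def pairProjector (t : ℕ) :
    Matrix (QubitCopies t × QubitCopies t) (QubitCopies t × QubitCopies t) ℂ :=
  Matrix.reindex (regroup t).symm (regroup t).symm (haarMoment (Fin 2 × Fin 2) t)

/-- `M_{t,3} = ½ (P₁₂ ⊗ I₃ + I₁ ⊗ P₂₃)`, on `2t` copies of each of three qubits. -/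
def threeQubitMoment (t : ℕ) :
    Matrix (QubitCopies t × QubitCopies t × QubitCopies t)
      (QubitCopies t × QubitCopies t × QubitCopies t) ℂ :=
  (1 / 2 : ℂ) •
    (Matrix.reindex (Equiv.prodAssoc _ _ _) (Equiv.prodAssoc _ _ _)
        (pairProjector t ⊗ₖ (1 : Matrix (QubitCopies t) (QubitCopies t) ℂ)) +
      (1 : Matrix (QubitCopies t) (QubitCopies t) ℂ) ⊗ₖ pairProjector t)

/-! ### The second largest eigenvalue -/

/-- The set of real eigenvalues of a complex matrix (all its eigenvalues, if it is Hermitian). -/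
def realEigenvalues {ι : Type*} [Fintype ι] [DecidableEq ι] (A : Matrix ι ι ℂ) : Set ℝ :=
  {x | Module.End.HasEigenvalue (Matrix.toLin' A) (x : ℂ)}

/-- `x` is the second largest eigenvalue of the Hermitian matrix `A`, where eigenvalues are
counted without multiplicity: `x` is the largest eigenvalue other than the top one. -/
def IsSecondLargestEigenvalue {ι : Type*} [Fintype ι] [DecidableEq ι]
    (A : Matrix ι ι ℂ) (x : ℝ) : Prop :=
  A.IsHermitian ∧
    ∃ l : ℝ, IsGreatest (realEigenvalues A) l ∧ IsGreatest (realEigenvalues A \ {l}) x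

end RandomCircuit

end

open MeasureTheory
open scoped Kronecker

noncomputable section

namespace RandomCircuit

/-! ### Tensor powers of matrices -/

section TensorPow

variable {m : Type*}

/-! By invariance of Haar measure, `P` is the orthogonal projection onto the vectors fixed by all
`U^{⊗t} ⊗ Ū^{⊗t}`, that is, onto the vectorized commutant of the `U^{⊗t}`. As `t ≤ 4`, the commutant
is spanned by the permutation operators (`mem_span_permVec_of_invariant`). On pairs of qubits these
vectors factor as `ψ_σ ⊗ ψ_σ`, so `P (ψ_σ ⊗ ψ_τ)` is found by solving normal equations in the
overlaps of the `ψ_σ`.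

Write `A = P₁₂ ⊗ I₃` and `B = I₁ ⊗ P₂₃`. If `(A + B) v = 2x v`, then `A B (A v) = (2x - 1)² A v`, so
it suffices to know the nonzero eigenvalues of `A B`, whose range lies in the span of the `ψ_σ ⊗ ψ_σ
⊗ ψ_τ`. This span is filtered by `diagonalSpan ≤ oddSpan`. On `diagonalSpan` the operator is the
identity; on `oddSpan` modulo `diagonalSpan` it is the scalar `4/25`; modulo `oddSpan` it is
annihilated by `x (x - 1/100) (x - 1/25)` (`pairProduct_eigenvalue`). Hence `(2x - 1)²` is `1` or at
most `4/25`, which gives `x = 1` or `x ≤ 7/10`. The value `7/10` is attained because `4/25` has an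
explicit eigenvector built from the identity and a transposition. -/

theorem tensorPow_mul [Fintype m] (t : ℕ) (A B : Matrix m m ℂ) :
    tensorPow t (A * B) = tensorPow t A * tensorPow t B := by
  ext i j
  simp only [tensorPow, Matrix.of_apply, Matrix.mul_apply, ← Finset.prod_mul_distrib]
  exact Fintype.prod_sum fun k x => A (i k) x * B x (j k)

theorem tensorPow_diagonal [DecidableEq m] (t : ℕ) (d : m → ℂ) :
    tensorPow t (Matrix.diagonal d) = Matrix.diagonal fun i => ∏ k, d (i k) := by
  ext i j
  by_cases h : i = j
  · subst h
    simp [tensorPow]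
  · obtain ⟨k, hk⟩ := Function.ne_iff.mp h
    rw [Matrix.diagonal_apply_ne _ h]
    exact Finset.prod_eq_zero (Finset.mem_univ k) (Matrix.diagonal_apply_ne _ hk)

theorem tensorPow_one [DecidableEq m] (t : ℕ) : tensorPow t (1 : Matrix m m ℂ) = 1 := by
  rw [← Matrix.diagonal_one, tensorPow_diagonal]
  simp

theorem tensorPow_conjTranspose (t : ℕ) (A : Matrix m m ℂ) :
    tensorPow t A.conjTranspose = (tensorPow t A).conjTranspose := by
  ext i j
  simp [tensorPow]

theorem tensorPow_map_star (t : ℕ) (A : Matrix m m ℂ) :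
    tensorPow t (A.map star) = (tensorPow t A).map star := by
  ext i j
  simp [tensorPow]

theorem tensorPowConj_mul [Fintype m] (t : ℕ) (A B : Matrix m m ℂ) :
    tensorPowConj t (A * B) = tensorPowConj t A * tensorPowConj t B := by
  have h : (A * B).map star = A.map star * B.map star := Matrix.map_mul (f := starRingEnd ℂ)
  rw [tensorPowConj, h, tensorPow_mul, tensorPow_mul, Matrix.mul_kronecker_mul]
  rfl

theorem tensorPowConj_conjTranspose (t : ℕ) (A : Matrix m m ℂ) :
    tensorPowConj t A.conjTranspose = (tensorPowConj t A).conjTranspose := by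
  rw [tensorPowConj, tensorPowConj, Matrix.conjTranspose_kronecker, ← tensorPow_conjTranspose,
    ← tensorPow_conjTranspose]
  rfl

/-- Vectorization turns `A ⊗ Ā` into `X ↦ A X A*`; this makes fixed vectors correspond to commuting
matrices. -/
theorem tensorPowConj_mulVec_apply [Fintype m] {t : ℕ} (U : Matrix m m ℂ)
    (v : (Fin t → m) × (Fin t → m) → ℂ) (i j : Fin t → m) :
    (tensorPowConj t U).mulVec v (i, j) =
      (tensorPow t U * Matrix.of (fun i j => v (i, j)) * (tensorPow t U).conjTranspose) i j := by
  simp only [tensorPowConj, tensorPow_map_star, Matrix.mulVec, dotProduct, Matrix.mul_apply,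
    Matrix.kroneckerMap_apply, Matrix.conjTranspose_apply, Matrix.map_apply, Matrix.of_apply,
    Fintype.sum_prod_type, Finset.sum_mul]
  rw [Finset.sum_comm]
  exact Finset.sum_congr rfl fun _ _ => Finset.sum_congr rfl fun _ _ => by ring

theorem prod_update_one_apply [DecidableEq m] {t : ℕ} (x : m) (z : ℂ) (i : Fin t → m) :
    ∏ k, Function.update (1 : m → ℂ) x z (i k) = z ^ (Finset.univ.filter (i · = x)).card := by
  simp only [Function.update_apply, Pi.one_apply, Finset.prod_ite, Finset.prod_const_one, mul_one,
    Finset.prod_const]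

/-- The matrix of the linear map sending the basis vector `x` to the basis vector `f x`. -/
def functionMatrix [DecidableEq m] (f : m → m) : Matrix m m ℂ :=
  Matrix.of fun x y => if x = f y then 1 else 0

theorem tensorPow_functionMatrix_apply [DecidableEq m] {t : ℕ} (f : m → m) (i j : Fin t → m) :
    tensorPow t (functionMatrix f) i j = if i = f ∘ j then 1 else 0 := by
  simp only [tensorPow, functionMatrix, Matrix.of_apply, Fintype.prod_ite_zero, funext_iff,
    Function.comp_apply, Finset.prod_const_one]

end TensorPow

/-! ### The Haar moment operator is the orthogonal projection onto the invariant vectors -/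

section HaarMoment

variable {m : Type*} [Fintype m] [DecidableEq m]

instance : (haarUnitary m).IsMulLeftInvariant := by
  unfold haarUnitary; infer_instance

instance : IsProbabilityMeasure (haarUnitary m) :=
  ⟨by
    simpa [haarUnitary] using Measure.haarMeasure_self
      (K₀ := (⊤ : TopologicalSpace.PositiveCompacts (Matrix.unitaryGroup m ℂ)))⟩

theorem continuous_tensorPowConj_apply (t : ℕ) (i j : (Fin t → m) × (Fin t → m)) :
    Continuous fun U : Matrix.unitaryGroup m ℂ => tensorPowConj t (U : Matrix m m ℂ) i j := by
  have h (a b : m) : Continuous fun U : Matrix.unitaryGroup m ℂ => (U : Matrix m m ℂ) a b :=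
    continuous_subtype_val.matrix_elem a b
  have h1 (i j : Fin t → m) :
      Continuous fun U : Matrix.unitaryGroup m ℂ => tensorPow t (U : Matrix m m ℂ) i j := by
    simp only [tensorPow, Matrix.of_apply]
    exact continuous_finsetProd _ fun k _ => h (i k) (j k)
  simp only [tensorPowConj, tensorPow_map_star, Matrix.kroneckerMap_apply, Matrix.map_apply]
  exact (h1 _ _).mul (h1 _ _).star

theorem integrable_tensorPowConj_apply (t : ℕ) (i j : (Fin t → m) × (Fin t → m)) :
    Integrable (fun U : Matrix.unitaryGroup m ℂ => tensorPowConj t (U : Matrix m m ℂ) i j)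
      (haarUnitary m) :=
  (continuous_tensorPowConj_apply t i j).integrable_of_hasCompactSupport
    (HasCompactSupport.of_compactSpace _)

/-- Left invariance of Haar measure absorbs `U`. -/
theorem tensorPowConj_mul_haarMoment (t : ℕ) (U : Matrix.unitaryGroup m ℂ) :
    tensorPowConj t (U : Matrix m m ℂ) * haarMoment m t = haarMoment m t := by
  ext i j
  simp only [haarMoment, Matrix.mul_apply, Matrix.of_apply]
  rw [← integral_mul_left_eq_self _ U]
  simp only [Submonoid.coe_mul, tensorPowConj_mul, Matrix.mul_apply, ← integral_const_mul]
  rw [integral_finsetSum]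
  exact fun k _ => (integrable_tensorPowConj_apply t k j).const_mul _

/-- A vector fixed by all `U^{⊗ t} ⊗ Ū^{⊗ t}` is fixed by the Haar moment operator. -/
theorem haarMoment_mulVec_of_invariant (t : ℕ) (v : (Fin t → m) × (Fin t → m) → ℂ)
    (hv : ∀ U : Matrix.unitaryGroup m ℂ, (tensorPowConj t (U : Matrix m m ℂ)).mulVec v = v) :
    (haarMoment m t).mulVec v = v := by
  ext i
  have h (U : Matrix.unitaryGroup m ℂ) :
      ∑ j, tensorPowConj t (U : Matrix m m ℂ) i j * v j = v i := congrFun (hv U) i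
  simp only [haarMoment, Matrix.mulVec, dotProduct, Matrix.of_apply, ← integral_mul_const]
  rw [← integral_finsetSum _ fun j _ => (integrable_tensorPowConj_apply t i j).mul_const _]
  simp [h]

/-- Integrating the absorption identity for `U⁻¹` over `U` produces the adjoint on the left. This
one identity yields both self-adjointness and idempotence, using left invariance only. -/
theorem haarMoment_conjTranspose_mul_self (t : ℕ) :
    (haarMoment m t).conjTranspose * haarMoment m t = haarMoment m t := by
  ext i j
  have h (U : Matrix.unitaryGroup m ℂ) :
      ∑ k, star (tensorPowConj t (U : Matrix m m ℂ) k i) * haarMoment m t k j =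
        haarMoment m t i j := by
    have h1 := tensorPowConj_mul_haarMoment t U⁻¹
    rw [Matrix.UnitaryGroup.inv_val, Matrix.star_eq_conjTranspose, tensorPowConj_conjTranspose]
      at h1
    exact congrFun (congrFun h1 i) j
  simp only [Matrix.mul_apply, Matrix.conjTranspose_apply]
  have h2 (k : (Fin t → m) × (Fin t → m)) : star (haarMoment m t k i) =
      ∫ U : Matrix.unitaryGroup m ℂ, star (tensorPowConj t (U : Matrix m m ℂ) k i)
        ∂(haarUnitary m) := integral_conj.symm
  simp only [h2, ← integral_mul_const]
  rw [← integral_finsetSum]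
  · simp only [h, integral_const, probReal_univ, one_smul]
  · exact fun k _ => ((continuous_tensorPowConj_apply t k i).star.integrable_of_hasCompactSupport
      (HasCompactSupport.of_compactSpace _)).mul_const _

theorem haarMoment_isHermitian (t : ℕ) : (haarMoment m t).IsHermitian := by
  have h := Matrix.isHermitian_conjTranspose_mul_self (haarMoment m t)
  rwa [haarMoment_conjTranspose_mul_self] at h

theorem haarMoment_mul_self (t : ℕ) : haarMoment m t * haarMoment m t = haarMoment m t := by
  have h := haarMoment_conjTranspose_mul_self (m := m) t
  rwa [(haarMoment_isHermitian t).eq] at h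

end HaarMoment

/-! ### Matrices commuting with all `U^{⊗ t}` -/

section Commutant

variable {m : Type*} [Fintype m] [DecidableEq m]

/-- The vectorization of the operator permuting the factors of `(ℂ^m)^{⊗ t}` by `σ`. -/
def permVec (m : Type*) [DecidableEq m] {t : ℕ} (σ : Equiv.Perm (Fin t)) :
    (Fin t → m) × (Fin t → m) → ℂ :=
  fun p => if p.1 = p.2 ∘ σ then 1 else 0

theorem diagonal_mem_unitaryGroup {d : m → ℂ} (hd : ∀ x, d x * star (d x) = 1) :
    Matrix.diagonal d ∈ Matrix.unitaryGroup m ℂ := by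
  rw [Matrix.mem_unitaryGroup_iff, Matrix.star_eq_conjTranspose, Matrix.diagonal_conjTranspose,
    Matrix.diagonal_mul_diagonal]
  simp only [Pi.star_apply, hd, Matrix.diagonal_one]

variable {t : ℕ} {X : Matrix (Fin t → m) (Fin t → m) ℂ}

/-- Commuting with the diagonal unitary that has `z` at `x` and `1` elsewhere forces equal powers of
`z`. The counts are at most `t`, so a primitive root of unity of order `t + 1` separates them. -/
theorem card_filter_eq_of_commute
    (hX : ∀ U ∈ Matrix.unitaryGroup m ℂ, tensorPow t U * X = X * tensorPow t U)
    {i j : Fin t → m} (hij : X i j ≠ 0) (x : m) :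
    (Finset.univ.filter (i · = x)).card = (Finset.univ.filter (j · = x)).card := by
  have hz := Complex.isPrimitiveRoot_exp (t + 1) t.succ_ne_zero
  set z := Complex.exp (2 * Real.pi * Complex.I / (t + 1 : ℕ))
  have hz1 : z * star z = 1 := by
    have h := hz.norm'_eq_one t.succ_ne_zero
    rw [Complex.star_def, Complex.mul_conj, Complex.normSq_eq_norm_sq, h]
    norm_num
  have hU : Matrix.diagonal (Function.update (1 : m → ℂ) x z) ∈ Matrix.unitaryGroup m ℂ := by
    refine diagonal_mem_unitaryGroup fun y => ?_
    by_cases h : y = x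
    · subst h; simpa using hz1
    · simp [Function.update_of_ne h]
  have h := congrFun (congrFun (hX _ hU) i) j
  rw [tensorPow_diagonal, Matrix.diagonal_mul, Matrix.mul_diagonal, prod_update_one_apply,
    prod_update_one_apply, mul_comm] at h
  have hlt (i : Fin t → m) : (Finset.univ.filter (i · = x)).card < t + 1 :=
    Nat.lt_succ_of_le ((Finset.card_filter_le _ _).trans (by simp))
  exact hz.pow_inj (hlt i) (hlt j) (mul_left_cancel₀ hij h)

/-- The diagonal entries of a tensor power depend only on the letter counts of the index, and `X`
preserves these. This extends commutation from unitary to arbitrary, possibly singular, diagonal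
matrices. -/
theorem tensorPow_diagonal_commute
    (hX : ∀ U ∈ Matrix.unitaryGroup m ℂ, tensorPow t U * X = X * tensorPow t U) (d : m → ℂ) :
    tensorPow t (Matrix.diagonal d) * X = X * tensorPow t (Matrix.diagonal d) := by
  ext i j
  rw [tensorPow_diagonal, Matrix.diagonal_mul, Matrix.mul_diagonal, mul_comm]
  by_cases hij : X i j = 0
  · simp [hij]
  congr 1
  have h (i : Fin t → m) : ∏ k, d (i k) = ∏ x, d x ^ (Finset.univ.filter (i · = x)).card := by
    rw [← Finset.prod_fiberwise' Finset.univ i d]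
    simp
  rw [h, h]
  exact Finset.prod_congr rfl fun x _ => by rw [card_filter_eq_of_commute hX hij x]

/-- The rows of a function matrix have disjoint supports, so the nonzero ones, once normalized,
extend to an orthonormal basis; the diagonal factor restores the row norms. -/
theorem functionMatrix_eq_diagonal_mul (f : m → m) :
    ∃ d : m → ℂ, ∃ W ∈ Matrix.unitaryGroup m ℂ, functionMatrix f = Matrix.diagonal d * W := by
  let n (x : m) : ℝ := ((Finset.univ.filter (x = f ·)).card : ℝ)
  let v (x : m) : EuclideanSpace ℂ m :=
    WithLp.toLp 2 fun y => if x = f y then ((Real.sqrt (n x))⁻¹ : ℂ) else 0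
  have hn {x : m} (hx : x ∈ Set.range f) : (Real.sqrt (n x) : ℂ) ≠ 0 := by
    obtain ⟨y, rfl⟩ := hx
    rw [Complex.ofReal_ne_zero, Real.sqrt_ne_zero (Nat.cast_nonneg _), Nat.cast_ne_zero,
      Finset.card_ne_zero]
    exact ⟨y, by simp⟩
  have hv : Orthonormal ℂ ((Set.range f).domRestrict v) := by
    rw [orthonormal_iff_ite]
    rintro ⟨x, hx⟩ ⟨y, hy⟩
    simp only [Set.domRestrict_apply, Subtype.mk.injEq]
    split_ifs with hxy
    · subst hxy
      have h1 : (Real.sqrt (n x) : ℂ)⁻¹ * (Real.sqrt (n x) : ℂ)⁻¹ * (n x : ℂ) = 1 := by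
        have h2 := hn hx
        have h3 : (n x : ℂ) = Real.sqrt (n x) * Real.sqrt (n x) := by
          rw [← Complex.ofReal_mul, Real.mul_self_sqrt (Nat.cast_nonneg _)]
        rw [h3]
        field_simp
      rw [← h1]
      have h2 (z : m) : inner ℂ (v x z) (v x z) =
          if x = f z then (Real.sqrt (n x) : ℂ)⁻¹ * (Real.sqrt (n x) : ℂ)⁻¹ else 0 := by
        rw [RCLike.inner_apply]
        by_cases h : x = f z <;> simp [v, h]
      rw [PiLp.inner_apply, Finset.sum_congr rfl fun z _ => h2 z]
      simp [n, Finset.sum_ite, mul_comm]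
    · have h1 (z : m) (h : x = f z) : y ≠ f z := fun h' => hxy (h.trans h'.symm)
      simp only [v, PiLp.inner_apply]
      refine Finset.sum_eq_zero fun z _ => ?_
      by_cases h : x = f z
      · simp [h1 z h]
      · simp [h]
  -- The basis agrees with `v` only on the range of `f`. Elsewhere the fibre is empty, so the
  -- diagonal entry `√(n x) = 0` kills the arbitrary row.
  obtain ⟨b, hb⟩ := hv.exists_orthonormalBasis_extension_of_card_eq (by simp)
  refine ⟨fun x => (Real.sqrt (n x) : ℂ), Matrix.of fun x y => b x y, ?_, ?_⟩
  · rw [Matrix.mem_unitaryGroup_iff]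
    ext x y
    have h := orthonormal_iff_ite.mp b.orthonormal y x
    rw [Matrix.one_apply]
    simpa [Matrix.mul_apply, PiLp.inner_apply, eq_comm] using h
  · ext x y
    rw [Matrix.diagonal_mul]
    by_cases hx : x ∈ Set.range f
    · simp [hb x hx, functionMatrix, v, hn hx]
    · have h1 (y : m) : x ≠ f y := fun h => hx ⟨y, h.symm⟩
      simp [functionMatrix, h1, n]

theorem tensorPow_functionMatrix_commute
    (hX : ∀ U ∈ Matrix.unitaryGroup m ℂ, tensorPow t U * X = X * tensorPow t U) (f : m → m) :
    tensorPow t (functionMatrix f) * X = X * tensorPow t (functionMatrix f) := by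
  obtain ⟨d, W, hW, h⟩ := functionMatrix_eq_diagonal_mul f
  rw [h, tensorPow_mul, Matrix.mul_assoc, hX W hW, ← Matrix.mul_assoc,
    tensorPow_diagonal_commute hX, Matrix.mul_assoc]

theorem exists_perm_of_apply_ne_zero
    (hX : ∀ U ∈ Matrix.unitaryGroup m ℂ, tensorPow t U * X = X * tensorPow t U)
    {a : Fin t → m} (ha : Function.Injective a) {i : Fin t → m} (hi : X i a ≠ 0) :
    ∃ σ : Equiv.Perm (Fin t), i = a ∘ σ := by
  have h (x : m) := card_filter_eq_of_commute hX hi x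
  have h1 (k : Fin t) : ∃ l, a l = i k := by
    have h2 : (Finset.univ.filter (a · = i k)).Nonempty := by
      rw [← Finset.card_pos, ← h, Finset.card_pos]
      exact ⟨k, by simp⟩
    obtain ⟨l, hl⟩ := h2
    exact ⟨l, by simpa using hl⟩
  choose π hπ using h1
  have hsurj : Function.Surjective π := by
    intro l
    have h2 : (Finset.univ.filter (i · = a l)).Nonempty := by
      rw [← Finset.card_pos, h, Finset.card_pos]
      exact ⟨l, by simp⟩
    obtain ⟨k, hk⟩ := h2
    exact ⟨k, ha ((hπ k).trans (by simpa using hk))⟩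
  refine ⟨Equiv.ofBijective π (Finite.surjective_iff_bijective.mp hsurj), ?_⟩
  ext k
  exact (hπ k).symm

/-- An injective word `a` is carried to any word `j` by some letter map `f`, so commuting with
`f^{⊗t}` determines column `j` of `X` from column `a`. That column is supported on the
rearrangements of `a`. -/
theorem apply_eq_sum_perm_of_commute
    (hX : ∀ U ∈ Matrix.unitaryGroup m ℂ, tensorPow t U * X = X * tensorPow t U)
    {a : Fin t → m} (ha : Function.Injective a) (i j : Fin t → m) :
    X i j = ∑ σ : Equiv.Perm (Fin t), X (a ∘ σ) a * permVec m σ (i, j) := by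
  -- The default `id` outside the range of `a` plays no role.
  obtain ⟨f, hf⟩ : ∃ f : m → m, j = f ∘ a :=
    ⟨Function.extend a j id, (funext fun k => (ha.extend_apply j id k)).symm⟩
  have h := congrFun (congrFun (tensorPow_functionMatrix_commute hX f) i) a
  simp only [Matrix.mul_apply, tensorPow_functionMatrix_apply, mul_ite, mul_one, mul_zero,
    ← hf, Finset.sum_ite_eq', Finset.mem_univ, if_true] at h
  rw [← h]
  have hinj : Function.Injective fun σ : Equiv.Perm (Fin t) => a ∘ σ := by
    intro σ τ hστ
    ext k
    exact congrArg _ (ha (congrFun hστ k))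
  rw [← Finset.sum_subset (Finset.subset_univ (Finset.univ.image
    fun σ : Equiv.Perm (Fin t) => a ∘ σ))]
  · rw [Finset.sum_image fun _ _ _ _ h => hinj h]
    refine Finset.sum_congr rfl fun σ _ => ?_
    rw [mul_comm, permVec, hf]
    rfl
  · intro k _ hk
    have : X k a = 0 := by
      by_contra hne
      obtain ⟨σ, rfl⟩ := exists_perm_of_apply_ne_zero hX ha hne
      exact hk (Finset.mem_image_of_mem _ (Finset.mem_univ σ))
    rw [this, mul_zero]

theorem tensorPow_conjTranspose_mul_self {U : Matrix m m ℂ} (hU : U ∈ Matrix.unitaryGroup m ℂ) :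
    (tensorPow t U).conjTranspose * tensorPow t U = 1 := by
  rw [← tensorPow_conjTranspose, ← tensorPow_mul, ← Matrix.star_eq_conjTranspose,
    Matrix.mem_unitaryGroup_iff'.mp hU, tensorPow_one]

/-- If `t ≤ dim`, then every vector fixed by all `U^{⊗ t} ⊗ Ū^{⊗ t}` is a linear combination of
vectorized permutation operators. -/
theorem mem_span_permVec_of_invariant (ht : t ≤ Fintype.card m)
    (v : (Fin t → m) × (Fin t → m) → ℂ)
    (hv : ∀ U : Matrix.unitaryGroup m ℂ, (tensorPowConj t (U : Matrix m m ℂ)).mulVec v = v) :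
    v ∈ Submodule.span ℂ (Set.range (permVec m : Equiv.Perm (Fin t) → _)) := by
  obtain ⟨a⟩ : Nonempty (Fin t ↪ m) := Function.Embedding.nonempty_of_card_le (by simpa using ht)
  have hX : ∀ U ∈ Matrix.unitaryGroup m ℂ, tensorPow t U * Matrix.of (fun i j => v (i, j)) =
      Matrix.of (fun i j => v (i, j)) * tensorPow t U := by
    intro U hU
    have h : tensorPow t U * Matrix.of (fun i j => v (i, j)) * (tensorPow t U).conjTranspose =
        Matrix.of (fun i j => v (i, j)) := by
      ext i j
      rw [← tensorPowConj_mulVec_apply, hv ⟨U, hU⟩, Matrix.of_apply]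
    conv_rhs => rw [← h]
    rw [Matrix.mul_assoc, tensorPow_conjTranspose_mul_self hU, Matrix.mul_one]
  have h : v = ∑ σ : Equiv.Perm (Fin t), v (a ∘ σ, a) • permVec m σ := by
    ext ⟨i, j⟩
    simpa using apply_eq_sum_perm_of_commute hX a.injective i j
  rw [h]
  exact Submodule.sum_mem _ fun σ _ => Submodule.smul_mem _ _ (Submodule.subset_span ⟨σ, rfl⟩)

theorem tensorPowConj_mulVec_permVec (σ : Equiv.Perm (Fin t)) (U : Matrix.unitaryGroup m ℂ) :
    (tensorPowConj t (U : Matrix m m ℂ)).mulVec (permVec m σ) = permVec m σ := by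
  ext ⟨i, j⟩
  have h : tensorPow t (U : Matrix m m ℂ) * (tensorPow t (U : Matrix m m ℂ)).conjTranspose = 1 := by
    rw [← tensorPow_conjTranspose, ← tensorPow_mul, ← Matrix.star_eq_conjTranspose,
      Matrix.mem_unitaryGroup_iff.mp U.2, tensorPow_one]
  have h1 := congrFun (congrFun h (i ∘ σ.symm)) j
  have h2 (l : Fin t → m) :
      tensorPow t (U : Matrix m m ℂ) i (l ∘ σ) = tensorPow t (U : Matrix m m ℂ) (i ∘ σ.symm) l := by
    simp only [tensorPow, Matrix.of_apply]
    rw [← Equiv.prod_comp σ.symm]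
    simp
  rw [Matrix.mul_apply] at h1
  rw [tensorPowConj_mulVec_apply]
  simp only [Matrix.mul_apply, permVec, Matrix.of_apply, mul_ite, mul_one, mul_zero,
    Finset.sum_ite_eq', Finset.mem_univ, if_true, h2, h1, Matrix.one_apply,
    Equiv.comp_symm_eq]

theorem haarMoment_mulVec_permVec (σ : Equiv.Perm (Fin t)) :
    (haarMoment m t).mulVec (permVec m σ) = permVec m σ :=
  haarMoment_mulVec_of_invariant t _ (tensorPowConj_mulVec_permVec σ)

theorem haarMoment_mulVec_mem_span (ht : t ≤ Fintype.card m)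
    (v : (Fin t → m) × (Fin t → m) → ℂ) :
    (haarMoment m t).mulVec v ∈
      Submodule.span ℂ (Set.range (permVec m : Equiv.Perm (Fin t) → _)) := by
  refine mem_span_permVec_of_invariant ht _ fun U => ?_
  rw [Matrix.mulVec_mulVec, tensorPowConj_mul_haarMoment]

end Commutant

/-! ### The pair projector -/

section PairProjector

variable {t : ℕ}

/-- The vectorized permutation operator on all copies of one qubit. -/
abbrev qubitVec (σ : Equiv.Perm (Fin t)) : QubitCopies t → ℂ := permVec (Fin 2) σ

/-- The vectorized permutation operator on all copies of two qubits. -/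
def pairVec (x y : QubitCopies t → ℂ) : QubitCopies t × QubitCopies t → ℂ :=
  fun p => x p.1 * y p.2

/-- Permuting copies of a pair permutes the copies of each qubit in the same way, so the vector is a
product. -/
theorem permVec_comp_regroup (σ : Equiv.Perm (Fin t)) :
    permVec (Fin 2 × Fin 2) σ ∘ regroup t = pairVec (qubitVec σ) (qubitVec σ) := by
  ext ⟨x, y⟩
  simp only [permVec, regroup, pairVec, Function.comp_apply, Equiv.coe_fn_mk, funext_iff,
    Prod.mk.injEq, forall_and, mul_ite, mul_one, mul_zero, ← ite_and]
  simp only [and_comm]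

theorem pairProjector_mulVec (v : QubitCopies t × QubitCopies t → ℂ) :
    (pairProjector t).mulVec v =
      (haarMoment (Fin 2 × Fin 2) t).mulVec (v ∘ (regroup t).symm) ∘ regroup t := by
  rw [pairProjector, Matrix.reindex_apply, Matrix.submatrix_mulVec_equiv]
  rfl

theorem pairProjector_isHermitian (t : ℕ) : (pairProjector t).IsHermitian :=
  (haarMoment_isHermitian t).submatrix _

theorem pairProjector_mul_self (t : ℕ) : pairProjector t * pairProjector t = pairProjector t := by
  simp only [pairProjector, Matrix.reindex_apply]
  rw [Matrix.submatrix_mul_equiv, haarMoment_mul_self]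

theorem pairProjector_mulVec_pairVec_self (σ : Equiv.Perm (Fin t)) :
    (pairProjector t).mulVec (pairVec (qubitVec σ) (qubitVec σ)) =
      pairVec (qubitVec σ) (qubitVec σ) := by
  rw [pairProjector_mulVec, ← permVec_comp_regroup, Function.comp_assoc, Equiv.self_comp_symm,
    Function.comp_id, haarMoment_mulVec_permVec]

/-- The vector `ψ_σ ⊗ ψ_σ` fixed by the pair projector. -/
abbrev diagVec (σ : Equiv.Perm (Fin t)) : QubitCopies t × QubitCopies t → ℂ :=
  pairVec (qubitVec σ) (qubitVec σ)

theorem pairProjector_mulVec_mem_span (ht : t ≤ 4) (v : QubitCopies t × QubitCopies t → ℂ) :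
    (pairProjector t).mulVec v ∈
      Submodule.span ℂ (Set.range (diagVec : Equiv.Perm (Fin t) → _)) := by
  have h := haarMoment_mulVec_mem_span (m := Fin 2 × Fin 2) (by simpa using ht)
    (v ∘ (regroup t).symm)
  have h1 := Submodule.mem_map_of_mem (f := LinearMap.funLeft ℂ ℂ (regroup t)) h
  rw [Submodule.map_span, ← Set.range_comp] at h1
  rw [pairProjector_mulVec]
  have h2 : LinearMap.funLeft ℂ ℂ (regroup t) ∘ permVec (Fin 2 × Fin 2) =
      (diagVec : Equiv.Perm (Fin t) → _) := funext permVec_comp_regroup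
  rwa [h2] at h1

open scoped ComplexOrder in
/-- A vector orthogonal to the range of the pair projector is annihilated by it. -/
theorem pairProjector_mulVec_eq_zero (ht : t ≤ 4) {v : QubitCopies t × QubitCopies t → ℂ}
    (hv : ∀ σ : Equiv.Perm (Fin t), star v ⬝ᵥ diagVec σ = 0) : (pairProjector t).mulVec v = 0 := by
  have h1 : ∀ y ∈ Submodule.span ℂ (Set.range (diagVec : Equiv.Perm (Fin t) → _)),
      star v ⬝ᵥ y = 0 := by
    intro y hy
    induction hy using Submodule.span_induction with
    | mem x hx => obtain ⟨σ, rfl⟩ := hx; exact hv σ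
    | zero => simp
    | add x y _ _ hx hy => rw [dotProduct_add, hx, hy, add_zero]
    | smul c x _ hx => rw [dotProduct_smul, hx, smul_zero]
  have h2 := h1 _ (pairProjector_mulVec_mem_span ht v)
  rw [← dotProduct_star_self_eq_zero, Matrix.star_mulVec,
    ← Matrix.dotProduct_mulVec, (pairProjector_isHermitian t).eq, Matrix.mulVec_mulVec,
    pairProjector_mul_self, h2]

/-! ### Overlaps and the normal equations -/

theorem pairVec_dotProduct_pairVec (a b c d : QubitCopies t → ℂ) :
    pairVec a b ⬝ᵥ pairVec c d = (a ⬝ᵥ c) * (b ⬝ᵥ d) := by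
  simp only [dotProduct, pairVec]
  rw [Finset.sum_mul_sum, Fintype.sum_prod_type]
  exact Finset.sum_congr rfl fun _ _ => Finset.sum_congr rfl fun _ _ => by ring

/-- The overlap of two vectorized permutation operators on qubits. -/
def permOverlap (σ τ : Equiv.Perm (Fin t)) : ℕ :=
  (Finset.univ.filter fun i : Fin t → Fin 2 => i ∘ σ = i ∘ τ).card

theorem qubitVec_dotProduct_qubitVec (σ τ : Equiv.Perm (Fin t)) :
    qubitVec σ ⬝ᵥ qubitVec τ = permOverlap σ τ := by
  simp only [dotProduct, permVec, permOverlap, Fintype.sum_prod_type_right, ite_mul, one_mul,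
    zero_mul, Finset.sum_ite_eq', Finset.mem_univ, if_true, Finset.sum_boole]

theorem star_pairVec_qubitVec (σ τ : Equiv.Perm (Fin t)) :
    star (pairVec (qubitVec σ) (qubitVec τ)) = pairVec (qubitVec σ) (qubitVec τ) := by
  ext p
  have h (σ : Equiv.Perm (Fin t)) (x : QubitCopies t) : star (qubitVec σ x) = qubitVec σ x := by
    rw [qubitVec, permVec]
    split_ifs <;> simp
  simp only [Pi.star_apply, pairVec, star_mul', h]

/-- The expansion of the projection of `ψ_σ ⊗ ψ_τ` from the normal equations. -/
theorem pairProjector_mulVec_pairVec (ht : t ≤ 4) {σ τ : Equiv.Perm (Fin t)}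
    (J : Equiv.Perm (Fin t) → ℝ)
    (hJ : ∀ β, (permOverlap σ β * permOverlap τ β : ℝ) = ∑ α, J α * (permOverlap α β : ℝ) ^ 2) :
    (pairProjector t).mulVec (pairVec (qubitVec σ) (qubitVec τ)) =
      ∑ α, (J α : ℂ) • diagVec α := by
  have h : (pairProjector t).mulVec (pairVec (qubitVec σ) (qubitVec τ) -
      ∑ α, (J α : ℂ) • diagVec α) = 0 := by
    refine pairProjector_mulVec_eq_zero ht fun β => ?_
    have h1 := congrArg (fun x : ℝ => (x : ℂ)) (hJ β)
    simp only [star_sub, star_sum, star_smul, star_pairVec_qubitVec, sub_dotProduct,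
      sum_dotProduct, smul_dotProduct, pairVec_dotProduct_pairVec, qubitVec_dotProduct_qubitVec]
    push_cast at h1
    simp only [h1, Complex.star_def, Complex.conj_ofReal, smul_eq_mul, ← sq, sub_self]
  rw [Matrix.mulVec_sub, sub_eq_zero] at h
  rw [h, Matrix.mulVec_sum]
  simp only [Matrix.mulVec_smul, pairProjector_mulVec_pairVec_self]

end PairProjector

/-! ### Projections of products of permutation vectors for two and three copies -/

section Overlaps

open Equiv.Perm (sign)

theorem permOverlap_fin_two : ∀ σ τ : Equiv.Perm (Fin 2),
    permOverlap σ τ = if σ = τ then 4 else 2 := by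
  unfold permOverlap
  decide

/-- The overlap is `2` to the number of cycles of `σ τ⁻¹`: three for the identity, one for a
3-cycle, two for a transposition. -/
theorem permOverlap_fin_three : ∀ σ τ : Equiv.Perm (Fin 3),
    permOverlap σ τ = if σ = τ then 8 else if sign σ = sign τ then 2 else 4 := by
  unfold permOverlap
  decide

/-- When the signs differ, one of the two overlaps with `β` is always twice the other, and `5ab =
2(a² + b²)` is equivalent to `(a - 2b)(2a - b) = 0`. -/
theorem five_mul_permOverlap_mul {t : ℕ} (ht : t = 2 ∨ t = 3) {σ τ : Equiv.Perm (Fin t)}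
    (h : sign σ ≠ sign τ) (β : Equiv.Perm (Fin t)) :
    5 * (permOverlap σ β * permOverlap τ β) =
      2 * (permOverlap σ β ^ 2 + permOverlap τ β ^ 2) := by
  obtain rfl | rfl := ht
  · simp only [permOverlap_fin_two]
    revert σ τ β
    decide
  · simp only [permOverlap_fin_three]
    revert σ τ β
    decide

theorem sum_permOverlap_sq (σ β : Equiv.Perm (Fin 3)) :
    ∑ α with sign α ≠ sign σ, permOverlap α β ^ 2 = if sign σ = sign β then 48 else 72 := by
  simp only [permOverlap_fin_three]
  revert σ β
  decide

theorem exists_third_perm {t : ℕ} (ht : t = 2 ∨ t = 3) {σ τ : Equiv.Perm (Fin t)} (hne : σ ≠ τ)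
    (h : sign σ = sign τ) : ∃ ρ, σ ≠ ρ ∧ τ ≠ ρ ∧ sign ρ = sign σ := by
  obtain rfl | rfl := ht
  · revert σ τ
    decide
  · revert σ τ
    decide

theorem eq_of_sign_eq_fin_two : ∀ σ τ : Equiv.Perm (Fin 2), sign σ = sign τ → σ = τ := by
  decide

theorem eq_or_eq_or_eq_of_sign_eq : ∀ σ τ : Equiv.Perm (Fin 3), σ ≠ τ → sign σ = sign τ →
    ∀ ρ β, σ ≠ ρ ∧ τ ≠ ρ ∧ sign ρ = sign σ ∧ sign σ = sign β → β = σ ∨ β = τ ∨ β = ρ := by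
  decide

/-- These are the normal equations for `σ`, `τ` in one coset of the alternating group, whose third
element is `ρ`. -/
theorem ten_mul_permOverlap_mul {σ τ ρ : Equiv.Perm (Fin 3)} (hστ : σ ≠ τ) (hσρ : σ ≠ ρ)
    (hτρ : τ ≠ ρ) (h1 : sign σ = sign τ) (h2 : sign ρ = sign σ) (β : Equiv.Perm (Fin 3)) :
    10 * (permOverlap σ β * permOverlap τ β) + permOverlap ρ β ^ 2 =
      permOverlap σ β ^ 2 + permOverlap τ β ^ 2 +
        2 * ∑ α with sign α ≠ sign σ, permOverlap α β ^ 2 := by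
  rw [sum_permOverlap_sq]
  simp only [permOverlap_fin_three]
  by_cases h : sign σ = sign β
  · obtain rfl | rfl | rfl := eq_or_eq_or_eq_of_sign_eq σ τ hστ h1 ρ β ⟨hσρ, hτρ, h2, h⟩
    · simp [hστ.symm, hσρ.symm, ← h1, h2]
    · simp [hστ, hτρ.symm, h1, h2]
    · simp [hσρ, hτρ, ← h1, h2]
  · have hne {α : Equiv.Perm (Fin 3)} (hα : sign α = sign σ) : α ≠ β := by
      rintro rfl
      exact h hα.symm
    simp [hne rfl, hne h1.symm, hne h2, ← h1, h2, h]

theorem pairProjector_mulVec_of_sign_ne {t : ℕ} (ht : t = 2 ∨ t = 3) {σ τ : Equiv.Perm (Fin t)}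
    (h : sign σ ≠ sign τ) :
    (pairProjector t).mulVec (pairVec (qubitVec σ) (qubitVec τ)) =
      (2 / 5 : ℂ) • (diagVec σ + diagVec τ) := by
  rw [pairProjector_mulVec_pairVec (by omega)
    fun α => (if α = σ then 2 / 5 else 0) + if α = τ then 2 / 5 else 0]
  · push_cast
    simp [add_smul, Finset.sum_add_distrib, apply_ite Complex.ofReal, ite_smul]
  · intro β
    have h1 := congrArg (Nat.cast : ℕ → ℝ) (five_mul_permOverlap_mul ht h β)
    push_cast at h1
    simp only [add_mul, ite_mul, zero_mul, Finset.sum_add_distrib, Finset.sum_ite_eq',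
      Finset.mem_univ, if_true]
    linarith

theorem pairProjector_mulVec_of_sign_eq {t : ℕ} (ht : t = 2 ∨ t = 3) {σ τ ρ : Equiv.Perm (Fin t)}
    (hστ : σ ≠ τ) (hσρ : σ ≠ ρ) (hτρ : τ ≠ ρ) (h1 : sign σ = sign τ) (h2 : sign ρ = sign σ) :
    (pairProjector t).mulVec (pairVec (qubitVec σ) (qubitVec τ)) =
      (1 / 10 : ℂ) • (diagVec σ + diagVec τ - diagVec ρ) +
        (1 / 5 : ℂ) • ∑ α with sign α ≠ sign σ, diagVec α := by
  obtain rfl | rfl := ht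
  -- For `t = 2` the sign determines the permutation, so this case is vacuous.
  · exact absurd (eq_of_sign_eq_fin_two σ τ h1) hστ
  rw [pairProjector_mulVec_pairVec (by omega) fun α =>
    (((if α = σ then 1 / 10 else 0) + if α = τ then 1 / 10 else 0) + if α = ρ then -1 / 10 else 0) +
      if sign α ≠ sign σ then 1 / 5 else 0]
  · simp only [Complex.ofReal_add, apply_ite Complex.ofReal, Complex.ofReal_zero, add_smul,
      Finset.sum_add_distrib, ite_smul, zero_smul, Finset.sum_ite_eq',
      Finset.mem_univ, if_true, Finset.smul_sum, Finset.sum_filter]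
    push_cast
    simp only [smul_ite, smul_zero]
    module
  · intro β
    have h3 := congrArg (Nat.cast : ℕ → ℝ) (ten_mul_permOverlap_mul hστ hσρ hτρ h1 h2 β)
    push_cast [Finset.sum_filter] at h3
    simp only [add_mul, ite_mul, zero_mul, Finset.sum_add_distrib, Finset.sum_ite_eq',
      Finset.mem_univ, if_true]
    rw [← Finset.sum_filter, ← Finset.mul_sum, Finset.sum_filter]
    linarith

end Overlaps

/-! ### Three qubits -/

section ThreeQubits

open Equiv.Perm (sign)

variable {t : ℕ}

/-- `P₁₂ ⊗ I₃`. -/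
def firstPair (t : ℕ) : Matrix (QubitCopies t × QubitCopies t × QubitCopies t)
    (QubitCopies t × QubitCopies t × QubitCopies t) ℂ :=
  Matrix.reindex (Equiv.prodAssoc _ _ _) (Equiv.prodAssoc _ _ _)
    (pairProjector t ⊗ₖ (1 : Matrix (QubitCopies t) (QubitCopies t) ℂ))

/-- `I₁ ⊗ P₂₃`. -/
def lastPair (t : ℕ) : Matrix (QubitCopies t × QubitCopies t × QubitCopies t)
    (QubitCopies t × QubitCopies t × QubitCopies t) ℂ :=
  (1 : Matrix (QubitCopies t) (QubitCopies t) ℂ) ⊗ₖ pairProjector t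

theorem threeQubitMoment_eq (t : ℕ) :
    threeQubitMoment t = (1 / 2 : ℂ) • (firstPair t + lastPair t) := rfl

theorem firstPair_isHermitian (t : ℕ) : (firstPair t).IsHermitian := by
  have h : (pairProjector t ⊗ₖ (1 : Matrix (QubitCopies t) (QubitCopies t) ℂ)).IsHermitian := by
    rw [Matrix.IsHermitian, Matrix.conjTranspose_kronecker, (pairProjector_isHermitian t).eq,
      Matrix.conjTranspose_one]
  exact h.submatrix _

theorem lastPair_isHermitian (t : ℕ) : (lastPair t).IsHermitian := by
  rw [lastPair, Matrix.IsHermitian, Matrix.conjTranspose_kronecker,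
    (pairProjector_isHermitian t).eq, Matrix.conjTranspose_one]

theorem firstPair_mul_self (t : ℕ) : firstPair t * firstPair t = firstPair t := by
  rw [firstPair, Matrix.reindex_apply, Matrix.submatrix_mul_equiv, ← Matrix.mul_kronecker_mul,
    pairProjector_mul_self, Matrix.one_mul]

theorem lastPair_mul_self (t : ℕ) : lastPair t * lastPair t = lastPair t := by
  rw [lastPair, ← Matrix.mul_kronecker_mul, pairProjector_mul_self, Matrix.one_mul]

theorem threeQubitMoment_isHermitian (t : ℕ) : (threeQubitMoment t).IsHermitian := by
  rw [threeQubitMoment_eq, Matrix.IsHermitian, Matrix.conjTranspose_smul,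
    Matrix.conjTranspose_add, (firstPair_isHermitian t).eq, (lastPair_isHermitian t).eq]
  simp

/-- Tensoring a vector on the first two qubits with a vector `z` on the third one. -/
def tensorRight (z : QubitCopies t → ℂ) :
    (QubitCopies t × QubitCopies t → ℂ) →ₗ[ℂ]
      (QubitCopies t × QubitCopies t × QubitCopies t → ℂ) where
  toFun v := fun p => v (p.1, p.2.1) * z p.2.2
  map_add' _ _ := by ext; simp [add_mul]
  map_smul' _ _ := by ext; simp [mul_assoc]

/-- Tensoring a vector on the last two qubits with a vector `x` on the first one. -/
def tensorLeft (x : QubitCopies t → ℂ) :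
    (QubitCopies t × QubitCopies t → ℂ) →ₗ[ℂ]
      (QubitCopies t × QubitCopies t × QubitCopies t → ℂ) where
  toFun v := fun p => x p.1 * v p.2
  map_add' _ _ := by ext; simp [mul_add]
  map_smul' _ _ := by ext; simp [mul_left_comm]

theorem tensorRight_pairVec (x y z : QubitCopies t → ℂ) :
    tensorRight z (pairVec x y) = tensorLeft x (pairVec y z) := by
  ext p
  exact mul_assoc _ _ _

theorem firstPair_mulVec_tensorRight (z : QubitCopies t → ℂ)
    (v : QubitCopies t × QubitCopies t → ℂ) :
    (firstPair t).mulVec (tensorRight z v) = tensorRight z ((pairProjector t).mulVec v) := by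
  ext ⟨a, b, c⟩
  simp [firstPair, tensorRight, Matrix.mulVec, dotProduct, Fintype.sum_prod_type, Matrix.one_apply,
    Finset.sum_mul, mul_assoc]

theorem lastPair_mulVec_apply (v : QubitCopies t × QubitCopies t × QubitCopies t → ℂ)
    (a : QubitCopies t) (q : QubitCopies t × QubitCopies t) :
    (lastPair t).mulVec v (a, q) = (pairProjector t).mulVec (fun q => v (a, q)) q := by
  simp only [lastPair, Matrix.mulVec, dotProduct, Matrix.kroneckerMap_apply,
    Fintype.sum_prod_type (α₁ := QubitCopies t) (α₂ := QubitCopies t × QubitCopies t),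
    Matrix.one_apply, ite_mul, one_mul, zero_mul]
  rw [Finset.sum_eq_single a]
  · simp
  · intro b _ hb
    simp [hb.symm]
  · simp

theorem lastPair_mulVec_tensorLeft (x : QubitCopies t → ℂ)
    (v : QubitCopies t × QubitCopies t → ℂ) :
    (lastPair t).mulVec (tensorLeft x v) = tensorLeft x ((pairProjector t).mulVec v) := by
  ext ⟨a, q⟩
  rw [lastPair_mulVec_apply]
  exact congrFun (Matrix.mulVec_smul (pairProjector t) (x a) v) q

/-- The vector `ψ_σ ⊗ ψ_σ ⊗ ψ_τ`. -/
def tripleFirst (σ τ : Equiv.Perm (Fin t)) : QubitCopies t × QubitCopies t × QubitCopies t → ℂ :=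
  tensorRight (qubitVec τ) (diagVec σ)

/-- The vector `ψ_σ ⊗ ψ_τ ⊗ ψ_τ`. -/
def tripleLast (σ τ : Equiv.Perm (Fin t)) : QubitCopies t × QubitCopies t × QubitCopies t → ℂ :=
  tensorLeft (qubitVec σ) (diagVec τ)

theorem tripleFirst_self (σ : Equiv.Perm (Fin t)) : tripleFirst σ σ = tripleLast σ σ :=
  tensorRight_pairVec _ _ _

theorem firstPair_mulVec_tripleFirst (σ τ : Equiv.Perm (Fin t)) :
    (firstPair t).mulVec (tripleFirst σ τ) = tripleFirst σ τ := by
  rw [tripleFirst, firstPair_mulVec_tensorRight, pairProjector_mulVec_pairVec_self]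

theorem lastPair_mulVec_tripleLast (σ τ : Equiv.Perm (Fin t)) :
    (lastPair t).mulVec (tripleLast σ τ) = tripleLast σ τ := by
  rw [tripleLast, lastPair_mulVec_tensorLeft, pairProjector_mulVec_pairVec_self]

theorem firstPair_mulVec_tripleLast_of_sign_ne (ht : t = 2 ∨ t = 3) {σ τ : Equiv.Perm (Fin t)}
    (h : sign σ ≠ sign τ) :
    (firstPair t).mulVec (tripleLast σ τ) =
      (2 / 5 : ℂ) • (tripleFirst σ τ + tripleFirst τ τ) := by
  rw [tripleLast, ← tensorRight_pairVec, firstPair_mulVec_tensorRight,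
    pairProjector_mulVec_of_sign_ne ht h, map_smul, map_add]
  rfl

theorem lastPair_mulVec_tripleFirst_of_sign_ne (ht : t = 2 ∨ t = 3) {σ τ : Equiv.Perm (Fin t)}
    (h : sign σ ≠ sign τ) :
    (lastPair t).mulVec (tripleFirst σ τ) =
      (2 / 5 : ℂ) • (tripleLast σ σ + tripleLast σ τ) := by
  rw [tripleFirst, tensorRight_pairVec, lastPair_mulVec_tensorLeft,
    pairProjector_mulVec_of_sign_ne ht h, map_smul, map_add]
  rfl

theorem firstPair_mulVec_tripleLast_of_sign_eq (ht : t = 2 ∨ t = 3) {σ τ ρ : Equiv.Perm (Fin t)}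
    (hστ : σ ≠ τ) (hσρ : σ ≠ ρ) (hτρ : τ ≠ ρ) (h1 : sign σ = sign τ) (h2 : sign ρ = sign σ) :
    (firstPair t).mulVec (tripleLast σ τ) =
      (1 / 10 : ℂ) • (tripleFirst σ τ + tripleFirst τ τ - tripleFirst ρ τ) +
        (1 / 5 : ℂ) • ∑ α with sign α ≠ sign σ, tripleFirst α τ := by
  rw [tripleLast, ← tensorRight_pairVec, firstPair_mulVec_tensorRight,
    pairProjector_mulVec_of_sign_eq ht hστ hσρ hτρ h1 h2]
  simp only [map_add, map_sub, map_smul, map_sum]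
  rfl

theorem lastPair_mulVec_tripleFirst_of_sign_eq (ht : t = 2 ∨ t = 3) {σ τ ρ : Equiv.Perm (Fin t)}
    (hστ : σ ≠ τ) (hσρ : σ ≠ ρ) (hτρ : τ ≠ ρ) (h1 : sign σ = sign τ) (h2 : sign ρ = sign σ) :
    (lastPair t).mulVec (tripleFirst σ τ) =
      (1 / 10 : ℂ) • (tripleLast σ σ + tripleLast σ τ - tripleLast σ ρ) +
        (1 / 5 : ℂ) • ∑ α with sign α ≠ sign σ, tripleLast σ α := by
  rw [tripleFirst, tensorRight_pairVec, lastPair_mulVec_tensorLeft,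
    pairProjector_mulVec_of_sign_eq ht hστ hσρ hτρ h1 h2]
  simp only [map_add, map_sub, map_smul, map_sum]
  rfl

/-- The vectors `ψ_σ ⊗ ψ_σ ⊗ ψ_τ` span a space containing the range of `P₁₂ P₂₃`. -/
theorem firstPair_mulVec_lastPair_mulVec_mem_span (ht : t ≤ 4)
    (v : QubitCopies t × QubitCopies t × QubitCopies t → ℂ) :
    (firstPair t).mulVec ((lastPair t).mulVec v) ∈
      Submodule.span ℂ (Set.range fun p : Equiv.Perm (Fin t) × Equiv.Perm (Fin t) =>
        tripleFirst p.1 p.2) := by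
  have h (a : QubitCopies t) := (Submodule.mem_span_range_iff_exists_fun ℂ).mp
    (pairProjector_mulVec_mem_span ht fun q => v (a, q))
  choose c hc using h
  -- The expansion is made slice by slice in the first qubit; the coefficients then form an
  -- arbitrary first-qubit vector tensored with `ψ_τ ⊗ ψ_τ`.
  have h1 : (lastPair t).mulVec v =
      ∑ τ, tensorRight (qubitVec τ) (pairVec (fun a => c a τ) (qubitVec τ)) := by
    ext ⟨a, q⟩
    rw [lastPair_mulVec_apply, ← hc]
    simp [tensorRight, pairVec, mul_assoc]
  rw [h1, Matrix.mulVec_sum]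
  refine Submodule.sum_mem _ fun τ _ => ?_
  rw [firstPair_mulVec_tensorRight]
  have h2 := Submodule.mem_map_of_mem (f := tensorRight (qubitVec τ))
    (pairProjector_mulVec_mem_span ht (pairVec (fun a => c a τ) (qubitVec τ)))
  refine Submodule.map_span_le _ _ _ |>.mpr ?_ h2
  rintro _ ⟨σ, rfl⟩
  exact Submodule.subset_span ⟨(σ, τ), rfl⟩

end ThreeQubits

/-! ### The spectrum of `P₁₂ P₂₃` on its range -/

/-- A linear relation for an operator acting on six vectors `v a b` indexed by the ordered pairs
of distinct elements `a`, `b` of a three-element set. -/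
theorem cubic_relation_of_six_vectors {V ι : Type*} [AddCommGroup V] [Module ℂ V] (S : V →ₗ[ℂ] V)
    (v : ι → ι → V) {P : ι → ι → ι → Prop}
    (hP : ∀ a b c, P a b c → P b a c ∧ P b c a)
    (hS : ∀ a b c, P a b c → S (v a b) = (1 / 100 : ℂ) • (v a b - v c b - v a c + v b c))
    {a b c : ι} (h : P a b c) :
    S (S (S (v a b))) = (1 / 20 : ℂ) • S (S (v a b)) - (1 / 2500 : ℂ) • S (v a b) := by
  -- A swap and a 3-cycle generate all six orderings of the triple, so `hS` applies to all six
  -- vectors.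
  have h1 := (hP _ _ _ h).1
  have h2 := (hP _ _ _ h).2
  have h3 := (hP _ _ _ h2).2
  have h4 := (hP _ _ _ h2).1
  have h5 := (hP _ _ _ h3).1
  simp only [map_add, map_sub, map_smul, hS _ _ _ h, hS _ _ _ h1, hS _ _ _ h2, hS _ _ _ h3,
    hS _ _ _ h4, hS _ _ _ h5]
  module

section Spectrum

open Equiv.Perm (sign)

variable {t : ℕ}

/-- The operator `P₁₂ P₂₃`. -/
def pairProduct (t : ℕ) : (QubitCopies t × QubitCopies t × QubitCopies t → ℂ) →ₗ[ℂ]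
    (QubitCopies t × QubitCopies t × QubitCopies t → ℂ) :=
  (firstPair t * lastPair t).mulVecLin

theorem pairProduct_apply (v : QubitCopies t × QubitCopies t × QubitCopies t → ℂ) :
    pairProduct t v = (firstPair t).mulVec ((lastPair t).mulVec v) := by
  rw [Matrix.mulVec_mulVec]
  rfl

theorem pairProduct_tripleFirst_self (σ : Equiv.Perm (Fin t)) :
    pairProduct t (tripleFirst σ σ) = tripleFirst σ σ := by
  rw [pairProduct_apply, tripleFirst_self, lastPair_mulVec_tripleLast, ← tripleFirst_self,
    firstPair_mulVec_tripleFirst]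

theorem pairProduct_tripleFirst_of_sign_ne (ht : t = 2 ∨ t = 3) {σ τ : Equiv.Perm (Fin t)}
    (h : sign σ ≠ sign τ) :
    pairProduct t (tripleFirst σ τ) = (4 / 25 : ℂ) • tripleFirst σ τ +
      ((2 / 5 : ℂ) • tripleFirst σ σ + (4 / 25 : ℂ) • tripleFirst τ τ) := by
  rw [pairProduct_apply, lastPair_mulVec_tripleFirst_of_sign_ne ht h, Matrix.mulVec_smul,
    Matrix.mulVec_add, firstPair_mulVec_tripleLast_of_sign_ne ht h, ← tripleFirst_self,
    firstPair_mulVec_tripleFirst]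
  module

/-- The span of the vectors `ψ_σ ⊗ ψ_σ ⊗ ψ_σ`. -/
def diagonalSpan (t : ℕ) :
    Submodule ℂ (QubitCopies t × QubitCopies t × QubitCopies t → ℂ) :=
  Submodule.span ℂ (Set.range fun σ : Equiv.Perm (Fin t) => tripleFirst σ σ)

/-- The span of the vectors `ψ_σ ⊗ ψ_σ ⊗ ψ_τ` for `σ = τ` or `σ`, `τ` of different sign. -/
def oddSpan (t : ℕ) :
    Submodule ℂ (QubitCopies t × QubitCopies t × QubitCopies t → ℂ) :=
  Submodule.span ℂ {v | ∃ σ τ : Equiv.Perm (Fin t), (σ = τ ∨ sign σ ≠ sign τ) ∧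
    tripleFirst σ τ = v}

theorem tripleFirst_self_mem_diagonalSpan (σ : Equiv.Perm (Fin t)) :
    tripleFirst σ σ ∈ diagonalSpan t :=
  Submodule.subset_span ⟨σ, rfl⟩

theorem tripleFirst_mem_oddSpan {σ τ : Equiv.Perm (Fin t)} (h : σ = τ ∨ sign σ ≠ sign τ) :
    tripleFirst σ τ ∈ oddSpan t :=
  Submodule.subset_span ⟨σ, τ, h, rfl⟩

theorem diagonalSpan_le_oddSpan : diagonalSpan t ≤ oddSpan t := by
  refine Submodule.span_le.mpr ?_
  rintro _ ⟨σ, rfl⟩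
  exact tripleFirst_mem_oddSpan (Or.inl rfl)

theorem pairProduct_of_mem_diagonalSpan
    {v : QubitCopies t × QubitCopies t × QubitCopies t → ℂ} (hv : v ∈ diagonalSpan t) :
    pairProduct t v = v := by
  induction hv using Submodule.span_induction with
  | mem x hx => obtain ⟨σ, rfl⟩ := hx; exact pairProduct_tripleFirst_self σ
  | zero => exact map_zero _
  | add x y _ _ hx hy => rw [map_add, hx, hy]
  | smul c x _ hx => rw [map_smul, hx]

/-- Each projection contributes a factor `2/5` to the off-diagonal vector; all other terms are
diagonal. -/
theorem pairProduct_sub_mem_diagonalSpan (ht : t = 2 ∨ t = 3)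
    {v : QubitCopies t × QubitCopies t × QubitCopies t → ℂ} (hv : v ∈ oddSpan t) :
    pairProduct t v - (4 / 25 : ℂ) • v ∈ diagonalSpan t := by
  have h : oddSpan t ≤
      (diagonalSpan t).comap (pairProduct t - (4 / 25 : ℂ) • LinearMap.id) := by
    refine Submodule.span_le.mpr ?_
    rintro _ ⟨σ, τ, rfl | hne, rfl⟩
    · exact Submodule.sub_mem _
        (by rw [pairProduct_tripleFirst_self]; exact tripleFirst_self_mem_diagonalSpan σ)
        (Submodule.smul_mem _ _ (tripleFirst_self_mem_diagonalSpan σ))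
    · change pairProduct t (tripleFirst σ τ) - (4 / 25 : ℂ) • tripleFirst σ τ ∈ diagonalSpan t
      rw [pairProduct_tripleFirst_of_sign_ne ht hne, add_sub_cancel_left]
      exact Submodule.add_mem _ (Submodule.smul_mem _ _ (tripleFirst_self_mem_diagonalSpan σ))
        (Submodule.smul_mem _ _ (tripleFirst_self_mem_diagonalSpan τ))
  exact h hv

theorem pairProduct_mem_oddSpan (ht : t = 2 ∨ t = 3) :
    oddSpan t ≤ (oddSpan t).comap (pairProduct t) := by
  intro v hv
  have h := diagonalSpan_le_oddSpan (pairProduct_sub_mem_diagonalSpan ht hv)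
  exact (Submodule.sub_mem_iff_left _ (Submodule.smul_mem _ _ hv)).mp h

/-- Modulo `oddSpan` the opposite-sign and diagonal terms disappear, leaving an action on ordered
pairs within one coset of the alternating group, with factor `(1/10)²`. -/
theorem pairProduct_tripleFirst_of_sign_eq (ht : t = 2 ∨ t = 3) {σ τ ρ : Equiv.Perm (Fin t)}
    (hστ : σ ≠ τ) (hσρ : σ ≠ ρ) (hτρ : τ ≠ ρ) (h1 : sign σ = sign τ) (h2 : sign ρ = sign σ) :
    pairProduct t (tripleFirst σ τ) -
      (1 / 100 : ℂ) • (tripleFirst σ τ - tripleFirst ρ τ - tripleFirst σ ρ + tripleFirst τ ρ) ∈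
        oddSpan t := by
  have h3 : ∑ α with sign α ≠ sign σ, tripleFirst α τ ∈ oddSpan t :=
    Submodule.sum_mem _ fun α hα =>
      tripleFirst_mem_oddSpan (Or.inr (by simpa [← h1] using hα))
  have h4 : ∑ α with sign α ≠ sign σ, tripleFirst α ρ ∈ oddSpan t :=
    Submodule.sum_mem _ fun α hα =>
      tripleFirst_mem_oddSpan (Or.inr (by simpa [h2] using hα))
  have h5 : ∑ α with sign α ≠ sign σ, (firstPair t).mulVec (tripleLast σ α) ∈ oddSpan t := by
    refine Submodule.sum_mem _ fun α hα => ?_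
    have hα : sign σ ≠ sign α := by simpa [eq_comm] using hα
    rw [firstPair_mulVec_tripleLast_of_sign_ne ht hα]
    exact Submodule.smul_mem _ _ (Submodule.add_mem _ (tripleFirst_mem_oddSpan (Or.inr hα))
      (tripleFirst_mem_oddSpan (Or.inl rfl)))
  have hd (α : Equiv.Perm (Fin t)) : tripleFirst α α ∈ oddSpan t :=
    tripleFirst_mem_oddSpan (Or.inl rfl)
  have key : pairProduct t (tripleFirst σ τ) -
      (1 / 100 : ℂ) • (tripleFirst σ τ - tripleFirst ρ τ - tripleFirst σ ρ + tripleFirst τ ρ) =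
      (1 / 10 : ℂ) • tripleFirst σ σ + (1 / 100 : ℂ) • tripleFirst τ τ -
        (1 / 100 : ℂ) • tripleFirst ρ ρ +
        (1 / 50 : ℂ) • ∑ α with sign α ≠ sign σ, tripleFirst α τ -
        (1 / 50 : ℂ) • ∑ α with sign α ≠ sign σ, tripleFirst α ρ +
        (1 / 5 : ℂ) • ∑ α with sign α ≠ sign σ, (firstPair t).mulVec (tripleLast σ α) := by
    rw [pairProduct_apply, lastPair_mulVec_tripleFirst_of_sign_eq ht hστ hσρ hτρ h1 h2]
    simp only [Matrix.mulVec_add, Matrix.mulVec_sub, Matrix.mulVec_smul, Matrix.mulVec_sum]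
    rw [firstPair_mulVec_tripleLast_of_sign_eq ht hστ hσρ hτρ h1 h2,
      firstPair_mulVec_tripleLast_of_sign_eq ht hσρ hστ hτρ.symm h2.symm h1.symm,
      ← tripleFirst_self, firstPair_mulVec_tripleFirst]
    module
  rw [key]
  have hs {v : QubitCopies t × QubitCopies t × QubitCopies t → ℂ} (c : ℂ) (hv : v ∈ oddSpan t) :
      c • v ∈ oddSpan t := Submodule.smul_mem _ c hv
  exact add_mem (sub_mem (add_mem (sub_mem (add_mem (hs _ (hd σ)) (hs _ (hd τ))) (hs _ (hd ρ)))
    (hs _ h3)) (hs _ h4)) (hs _ h5)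

theorem pairProduct_cubic_mem_oddSpan (ht : t = 2 ∨ t = 3)
    (v : QubitCopies t × QubitCopies t × QubitCopies t → ℂ)
    (hv : v ∈ Submodule.span ℂ (Set.range fun p : Equiv.Perm (Fin t) × Equiv.Perm (Fin t) =>
        tripleFirst p.1 p.2)) :
    pairProduct t (pairProduct t (pairProduct t v)) - (1 / 20 : ℂ) • pairProduct t (pairProduct t v)
      + (1 / 2500 : ℂ) • pairProduct t v ∈ oddSpan t := by
  have hle := pairProduct_mem_oddSpan ht
  let T := pairProduct t
  have h : Submodule.span ℂ (Set.range fun p : Equiv.Perm (Fin t) × Equiv.Perm (Fin t) =>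
        tripleFirst p.1 p.2) ≤
      (oddSpan t).comap (T ∘ₗ T ∘ₗ T - (1 / 20 : ℂ) • (T ∘ₗ T) + (1 / 2500 : ℂ) • T) := by
    refine Submodule.span_le.mpr ?_
    rintro _ ⟨⟨σ, τ⟩, rfl⟩
    change T (T (T (tripleFirst σ τ))) - (1 / 20 : ℂ) • T (T (tripleFirst σ τ))
      + (1 / 2500 : ℂ) • T (tripleFirst σ τ) ∈ oddSpan t
    by_cases hodd : σ = τ ∨ sign σ ≠ sign τ
    · have h0 := tripleFirst_mem_oddSpan hodd
      exact add_mem (sub_mem (hle (hle (hle h0))) (Submodule.smul_mem _ _ (hle (hle h0))))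
        (Submodule.smul_mem _ _ (hle h0))
    push Not at hodd
    obtain ⟨hστ, hsign⟩ := hodd
    obtain ⟨ρ, hσρ, hτρ, hρ⟩ := exists_third_perm ht hστ hsign
    -- On the quotient by `oddSpan` the six-vector formula holds exactly.
    have h6 := cubic_relation_of_six_vectors ((oddSpan t).mapQ (oddSpan t) T hle)
      (fun a b => (oddSpan t).mkQ (tripleFirst a b))
      (P := fun a b c => a ≠ b ∧ a ≠ c ∧ b ≠ c ∧ sign a = sign b ∧ sign c = sign a)
      (fun a b c ⟨h1, h2, h3, h4, h5⟩ => ⟨⟨h1.symm, h3, h2, h4.symm, h5.trans h4⟩,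
        ⟨h3, h1.symm, h2.symm, h4.symm.trans h5.symm, h4⟩⟩)
      (fun a b c ⟨h1, h2, h3, h4, h5⟩ => (Submodule.Quotient.eq _).mpr
        (pairProduct_tripleFirst_of_sign_eq ht h1 h2 h3 h4 h5))
      ⟨hστ, hσρ, hτρ, hsign, hρ⟩
    have h7 : T (T (T (tripleFirst σ τ))) -
        ((1 / 20 : ℂ) • T (T (tripleFirst σ τ)) - (1 / 2500 : ℂ) • T (tripleFirst σ τ)) ∈
          oddSpan t := (Submodule.Quotient.eq _).mp h6
    convert h7 using 1
    abel
  exact h hv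

/-- An eigenvector with any other eigenvalue is pushed down the filtration: at each layer the
annihilating polynomial takes a nonzero value at `μ`. On `diagonalSpan` the operator is the
identity, which leaves no room for it. -/
theorem pairProduct_eigenvalue (ht : t = 2 ∨ t = 3)
    {w : QubitCopies t × QubitCopies t × QubitCopies t → ℂ} (hw : w ≠ 0) {μ : ℂ}
    (h : pairProduct t w = μ • w) :
    μ = 0 ∨ μ = 1 / 100 ∨ μ = 1 / 25 ∨ μ = 4 / 25 ∨ μ = 1 := by
  by_contra! hμ
  obtain ⟨h0, h1, h2, h3, h4⟩ := hμ
  have hspan : w ∈ Submodule.span ℂ (Set.range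
      fun p : Equiv.Perm (Fin t) × Equiv.Perm (Fin t) => tripleFirst p.1 p.2) := by
    rw [← Submodule.smul_mem_iff _ h0, ← h, pairProduct_apply]
    exact firstPair_mulVec_lastPair_mulVec_mem_span (by omega) w
  have hodd : w ∈ oddSpan t := by
    have h5 := pairProduct_cubic_mem_oddSpan ht w hspan
    simp only [h, map_smul] at h5
    have h6 : μ * (μ - 1 / 100) * (μ - 1 / 25) ≠ 0 :=
      mul_ne_zero (mul_ne_zero h0 (sub_ne_zero.mpr h1)) (sub_ne_zero.mpr h2)
    rw [← Submodule.smul_mem_iff _ h6]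
    convert h5 using 1
    module
  have hdiag : w ∈ diagonalSpan t := by
    rw [← Submodule.smul_mem_iff _ (sub_ne_zero.mpr h3), sub_smul, ← h]
    exact pairProduct_sub_mem_diagonalSpan ht hodd
  have h5 := pairProduct_of_mem_diagonalSpan hdiag
  rw [h, ← sub_eq_zero] at h5
  have h6 : (μ - 1) • w = 0 := by rw [sub_smul, one_smul, h5]
  exact (smul_ne_zero (sub_ne_zero.mpr h4) hw) h6

/-! ### From the product of the projections to their average -/

theorem threeQubitMoment_mulVec (v : QubitCopies t × QubitCopies t × QubitCopies t → ℂ) :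
    (threeQubitMoment t).mulVec v =
      (1 / 2 : ℂ) • ((firstPair t).mulVec v + (lastPair t).mulVec v) := by
  rw [threeQubitMoment_eq, Matrix.smul_mulVec, Matrix.add_mulVec]

theorem mem_realEigenvalues_iff {ι : Type*} [Fintype ι] [DecidableEq ι] (A : Matrix ι ι ℂ)
    (x : ℝ) : x ∈ realEigenvalues A ↔ ∃ v, v ≠ 0 ∧ A.mulVec v = (x : ℂ) • v := by
  rw [realEigenvalues, Set.mem_ofPred_eq]
  constructor
  · intro h
    obtain ⟨v, hv⟩ := h.exists_hasEigenvector
    exact ⟨v, hv.2, hv.apply_eq_smul⟩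
  · rintro ⟨v, hv, h⟩
    exact Module.End.hasEigenvalue_of_hasEigenvector
      (Module.End.hasEigenvector_iff.mpr ⟨Module.End.mem_eigenspace_iff.mpr h, hv⟩)

/-- Every eigenvalue of `M_{t,3}` is `1` or at most `7/10`. -/
theorem eq_one_or_le_of_mem_realEigenvalues (ht : t = 2 ∨ t = 3) {x : ℝ}
    (hx : x ∈ realEigenvalues (threeQubitMoment t)) : x = 1 ∨ x ≤ 7 / 10 := by
  obtain ⟨v, hv, h⟩ := (mem_realEigenvalues_iff _ _).mp hx
  rw [threeQubitMoment_mulVec] at h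
  have hsum : (firstPair t).mulVec v + (lastPair t).mulVec v = (2 * x : ℂ) • v := by
    rw [mul_smul, ← h, smul_smul]
    norm_num
  have hAA (u : QubitCopies t × QubitCopies t × QubitCopies t → ℂ) :
      (firstPair t).mulVec ((firstPair t).mulVec u) = (firstPair t).mulVec u := by
    rw [Matrix.mulVec_mulVec, firstPair_mul_self]
  have hBB (u : QubitCopies t × QubitCopies t × QubitCopies t → ℂ) :
      (lastPair t).mulVec ((lastPair t).mulVec u) = (lastPair t).mulVec u := by
    rw [Matrix.mulVec_mulVec, lastPair_mul_self]
  have hA : (firstPair t).mulVec ((lastPair t).mulVec v) =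
      (2 * x - 1 : ℂ) • (firstPair t).mulVec v := by
    have h1 := congrArg (firstPair t).mulVec hsum
    rw [Matrix.mulVec_add, Matrix.mulVec_smul, hAA] at h1
    rw [sub_smul, ← h1, one_smul, add_sub_cancel_left]
  have hB : (lastPair t).mulVec ((firstPair t).mulVec v) =
      (2 * x - 1 : ℂ) • (lastPair t).mulVec v := by
    have h1 := congrArg (lastPair t).mulVec hsum
    rw [Matrix.mulVec_add, Matrix.mulVec_smul, hBB] at h1
    rw [sub_smul, ← h1, one_smul, add_sub_cancel_right]
  -- If `A v = 0`, then `v` is an eigenvector of the projection `B / 2`-scaled part of the average,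
  -- so `2x` is `0` or `1`; otherwise `A v` is an eigenvector of `A B`.
  by_cases hw : (firstPair t).mulVec v = 0
  · right
    rw [hw, zero_add] at hsum
    rw [hw, Matrix.mulVec_zero, hsum, smul_smul] at hB
    have h1 := (smul_eq_zero.mp hB.symm).resolve_right hv
    have h2 : (2 * x - 1) * (2 * x) = 0 := by exact_mod_cast h1
    rcases mul_eq_zero.mp h2 with h3 | h3 <;> linarith
  · have h1 : pairProduct t ((firstPair t).mulVec v) =
        (((2 * x - 1) ^ 2 : ℝ) : ℂ) • (firstPair t).mulVec v := by
      rw [pairProduct_apply, hB, Matrix.mulVec_smul, hA, smul_smul]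
      push_cast
      rw [sq]
    have h2 : (2 * x - 1) ^ 2 = 0 ∨ (2 * x - 1) ^ 2 = 1 / 100 ∨ (2 * x - 1) ^ 2 = 1 / 25 ∨
        (2 * x - 1) ^ 2 = 4 / 25 ∨ (2 * x - 1) ^ 2 = 1 := by
      have := pairProduct_eigenvalue ht hw h1
      simp only [← Complex.ofReal_inj]
      push_cast at this ⊢
      exact this
    by_cases h3 : (2 * x - 1) ^ 2 = 1
    · have h4 : (2 * x) * (2 * x - 2) = 0 := by linarith
      rcases mul_eq_zero.mp h4 with h5 | h5
      · right; linarith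
      · left; linarith
    · right
      have h4 : (2 * x - 1) ^ 2 ≤ (2 / 5) ^ 2 := by
        rcases h2 with h | h | h | h | h
        · rw [h]; norm_num
        · rw [h]; norm_num
        · rw [h]; norm_num
        · rw [h]; norm_num
        · exact absurd h h3
      have h5 := (le_abs_self _).trans (abs_le_of_sq_le_sq h4 (by norm_num))
      linarith

/-! ### Eigenvectors attaining 1 and 7/10 -/

theorem qubitVec_apply (σ : Equiv.Perm (Fin t)) (i j : Fin t → Fin 2) :
    qubitVec σ (i, j) = if i = j ∘ σ then 1 else 0 := rfl

theorem tripleFirst_apply (σ τ : Equiv.Perm (Fin t)) (a b c : QubitCopies t) :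
    tripleFirst σ τ (a, b, c) = qubitVec σ a * qubitVec σ b * qubitVec τ c := rfl

theorem one_mem_realEigenvalues (t : ℕ) : (1 : ℝ) ∈ realEigenvalues (threeQubitMoment t) := by
  rw [mem_realEigenvalues_iff]
  refine ⟨tripleFirst 1 1, fun h => ?_, ?_⟩
  · have h1 := congrFun h ((0, 0), (0, 0), (0, 0))
    simp [tripleFirst_apply, qubitVec_apply] at h1
  · rw [threeQubitMoment_mulVec, firstPair_mulVec_tripleFirst, tripleFirst_self,
      lastPair_mulVec_tripleLast]
    push_cast
    module

theorem seven_tenths_mem_realEigenvalues (ht : t = 2 ∨ t = 3) :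
    (7 / 10 : ℝ) ∈ realEigenvalues (threeQubitMoment t) := by
  obtain ⟨k, l, hkl⟩ : ∃ k l : Fin t, k ≠ l := by
    obtain rfl | rfl := ht
    · exact ⟨0, 1, by decide⟩
    · exact ⟨0, 1, by decide⟩
  let s : Equiv.Perm (Fin t) := Equiv.swap k l
  have hs : sign (1 : Equiv.Perm (Fin t)) ≠ sign s := by
    rw [Equiv.Perm.sign_swap hkl, map_one]
    decide
  rw [mem_realEigenvalues_iff]
  -- The coefficients solve `a + 2/5 = 4a/25` and `b + 4/25 = 4b/25`, making `u` an eigenvector of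
  -- `A B` for `4/25`. Its mirror image `u'` satisfies `B u = (2/5) u'` and `A u' = (2/5) u`, so `u
  -- + u'` has eigenvalue `(1 + 2/5)/2` for the average.
  let u : QubitCopies t × QubitCopies t × QubitCopies t → ℂ :=
    tripleFirst 1 s - (10 / 21 : ℂ) • tripleFirst 1 1 - (4 / 21 : ℂ) • tripleFirst s s
  let u' : QubitCopies t × QubitCopies t × QubitCopies t → ℂ :=
    tripleLast 1 s - (4 / 21 : ℂ) • tripleLast 1 1 - (10 / 21 : ℂ) • tripleLast s s
  have hA : (firstPair t).mulVec u = u := by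
    simp only [u, Matrix.mulVec_sub, Matrix.mulVec_smul, firstPair_mulVec_tripleFirst]
  have hB' : (lastPair t).mulVec u' = u' := by
    simp only [u', Matrix.mulVec_sub, Matrix.mulVec_smul, lastPair_mulVec_tripleLast]
  have hB : (lastPair t).mulVec u = (2 / 5 : ℂ) • u' := by
    simp only [u, u', Matrix.mulVec_sub, Matrix.mulVec_smul,
      lastPair_mulVec_tripleFirst_of_sign_ne ht hs, tripleFirst_self, lastPair_mulVec_tripleLast]
    module
  have hA' : (firstPair t).mulVec u' = (2 / 5 : ℂ) • u := by
    simp only [u, u', Matrix.mulVec_sub, Matrix.mulVec_smul,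
      firstPair_mulVec_tripleLast_of_sign_ne ht hs, ← tripleFirst_self,
      firstPair_mulVec_tripleFirst]
    module
  refine ⟨u + u', fun h => ?_, ?_⟩
  · have h1 := congrArg (firstPair t).mulVec h
    rw [Matrix.mulVec_add, hA, hA', Matrix.mulVec_zero] at h1
    have h2 : u = 0 := by
      have h3 : (7 / 5 : ℂ) • u = 0 := by rw [← h1]; module
      exact (smul_eq_zero.mp h3).resolve_left (by norm_num)
    -- Since `s` moves `i`, the entry of `u` tested below sees only `tripleFirst 1 s`, with value
    -- `1`.
    let i : Fin t → Fin 2 := Pi.single k 1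
    have hi : i ≠ i ∘ s := fun h => by
      have := congrFun h k
      simp [i, s, hkl.symm] at this
    have hi' : i ∘ s ≠ i := hi.symm
    have h3 := congrFun h2 ((i, i), (i, i), (i ∘ s, i))
    simp [u, tripleFirst_apply, qubitVec_apply, hi, hi'] at h3
  · rw [threeQubitMoment_mulVec, Matrix.mulVec_add, Matrix.mulVec_add, hA, hA', hB, hB']
    push_cast
    module

end Spectrum

end RandomCircuit

end

theorem mainTheorem9 (t : ℕ) (ht : t = 2 ∨ t = 3) :
    RandomCircuit.IsSecondLargestEigenvalue (RandomCircuit.threeQubitMoment t) (7 / 10 : ℝ) := by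
  refine ⟨RandomCircuit.threeQubitMoment_isHermitian t, 1,
    ⟨RandomCircuit.one_mem_realEigenvalues t, fun x hx => ?_⟩,
    ⟨RandomCircuit.seven_tenths_mem_realEigenvalues ht, by norm_num⟩, fun x hx => ?_⟩
  · rcases RandomCircuit.eq_one_or_le_of_mem_realEigenvalues ht hx with h | h <;> linarith
  · exact (RandomCircuit.eq_one_or_le_of_mem_realEigenvalues ht hx.1).resolve_left hx.2
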